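/- Let $d\ge 1$. For $s\in\mathbb N\cup\{\infty\}$ let $W^s_2(\mathbb R^d)$ be the space of all complex-valued $f\in L_2(\mathbb R^d)$ whose weak derivatives $D^\alpha f$ belong to $L_2(\mathbb R^d)$ for all multi-indices $\alpha\in\mathbb N_0^d$ with $|\alpha|_1=\sum_{j=1}^d\alpha_j\le s$ (all multi-indices if $s=\infty$) and satisfy $\sum_{|\alpha|_1\le s}\|D^\alpha f\|_{L_2(\mathbb R^d)}^2<\infty$, with the inner product $$\langle f,g\rangle_{W^s_2(\mathbb R^d)}=\sum_{|\alpha|_1\le s}\langle D^\alpha f,D^\alpha g\rangle_{L_2(\mathbb R^d)}.$$ If $s$ is an integer with $s>d/2$, or if $s=\infty$, then $W^s_2(\mathbb R^d)$, each element being identified with its continuous representative, is a reproducing kernel Hilbert space of functions on $\mathbb R^d$. Its reproducing kernel $K_{d,s}$ is as follows. For integers $s>d/2$, $$K_{d,s}(x,t)=\int_{\mathbb R^d}\frac{\exp\left(2\pi\mathrm i\,(x-t)\cdot u\right)}{1+\sum_{0<|\alpha|_1\le s}\prod_{j=1}^d(2\pi u_j)^{2\alpha_j}}\,\mathrm du\qquad\text{for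 all }x,t\in\mathbb R^d,$$ where the integrand is integrable and $(x-t)\cdot u=\sum_{j=1}^d(x_j-t_j)u_j$. For $s=\infty$, $$K_{d,\infty}(x,t)=\prod_{j=1}^d\frac{2\left(\sin(x_j-t_j)-(x_j-t_j)\cos(x_j-t_j)\right)}{\pi\,(x_j-t_j)^3}\qquad\text{for all }x,t\in\mathbb R^d,$$ where a factor with $x_j=t_j$ is understood as its limit $\frac{2}{3\pi}$. -/

import Mathlib

open MeasureTheory
open scoped SchwartzMap InnerProductSpace ENNReal

noncomputable section

namespace SobolevKernel

/-- The mixed derivative `D^α = ∂₁^{α₁} ∂₂^{α₂} ⋯ ∂_d^{α_d}` of (complex valued, tempered)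
distributions on `ℝ^d`; `∂_j` is the derivative in the direction of the `j`-th unit vector. -/
def mixedDeriv (d : ℕ) (α : Fin d → ℕ) :
    𝓢'(EuclideanSpace ℝ (Fin d), ℂ) →L[ℂ] 𝓢'(EuclideanSpace ℝ (Fin d), ℂ) :=
  ((List.finRange d).map fun j =>
    (LineDeriv.lineDerivOpCLM ℂ 𝓢'(EuclideanSpace ℝ (Fin d), ℂ)
      (EuclideanSpace.single j (1 : ℝ))) ^ (α j)).prod

/-- The complex Hilbert space `L₂(ℝ^d)`, with Lebesgue measure. -/
abbrev L2 (d : ℕ) : Type := Lp ℂ 2 (volume : Measure (EuclideanSpace ℝ (Fin d)))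

/-- `g` is the weak derivative `D^α f`, for `f, g ∈ L₂(ℝ^d)`: the distribution `D^α f` is given
by the function `g`. See `isWeakDeriv_iff` for the formulation with test functions. -/
def IsWeakDeriv {d : ℕ} (α : Fin d → ℕ) (f g : L2 d) : Prop :=
  mixedDeriv d α (f : 𝓢'(EuclideanSpace ℝ (Fin d), ℂ)) = (g : 𝓢'(EuclideanSpace ℝ (Fin d), ℂ))

/-- The multi-indices `α ∈ ℕ^d` with `|α|₁ ≤ s`; for `s = ∞` these are all multi-indices. -/
abbrev MultiIndex (d : ℕ) (s : ℕ∞) : Type :=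
  {α : Fin d → ℕ // ((∑ j, α j : ℕ) : ℕ∞) ≤ s}

instance (d : ℕ) (s : ℕ∞) : Zero (MultiIndex d s) := ⟨⟨0, by simp⟩⟩

/-- The Sobolev space `W^s_2(ℝ^d)`, `s ∈ ℕ ∪ {∞}`. A function `f` in it is recorded as the family
`(D^α f)_{|α|₁ ≤ s}` of its weak derivatives, which all have to be in `L₂(ℝ^d)`, with
`∑_{|α|₁ ≤ s} ‖D^α f‖² < ∞`; the function itself is the member `α = 0` of the family. As a subspace
of the Hilbert sum of copies of `L₂(ℝ^d)`, the space carries the inner product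
`∑_{|α|₁ ≤ s} ⟪D^α f, D^α g⟫_{L₂}`; see `sobolevSpace_inner` and `exists_mem_sobolevSpace_iff`. -/
def sobolevSpace (d : ℕ) (s : ℕ∞) : Submodule ℂ (lp (fun _ : MultiIndex d s => L2 d) 2) where
  carrier := {f | ∀ α : MultiIndex d s, IsWeakDeriv α.1 (f 0) (f α)}
  add_mem' := by
    intro f g hf hg α
    have h1 := hf α
    have h2 := hg α
    simp only [IsWeakDeriv, ← Lp.toTemperedDistributionCLM_apply] at h1 h2 ⊢
    simp only [lp.coeFn_add, Pi.add_apply, map_add, h1, h2]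
  zero_mem' := by
    intro α
    simp only [IsWeakDeriv, ← Lp.toTemperedDistributionCLM_apply]
    simp only [lp.coeFn_zero, Pi.zero_apply, map_zero]
  smul_mem' := by
    intro c f hf α
    have h1 := hf α
    simp only [IsWeakDeriv, ← Lp.toTemperedDistributionCLM_apply] at h1 ⊢
    simp only [lp.coeFn_smul, Pi.smul_apply, map_smul, h1]

/-- The underlying `L₂` function of an element of the Sobolev space. -/
def toL2 {d : ℕ} {s : ℕ∞} (f : sobolevSpace d s) : L2 d := f.1 0

theorem mem_sobolevSpace_iff {d : ℕ} {s : ℕ∞} (f : lp (fun _ : MultiIndex d s => L2 d) 2) :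
    f ∈ sobolevSpace d s ↔ ∀ α : MultiIndex d s, IsWeakDeriv α.1 (f 0) (f α) := Iff.rfl

theorem isClosed_sobolevSpace (d : ℕ) (s : ℕ∞) :
    IsClosed (sobolevSpace d s : Set (lp (fun _ : MultiIndex d s => L2 d) 2)) := by
  have h : (sobolevSpace d s : Set (lp (fun _ : MultiIndex d s => L2 d) 2)) =
      ⋂ α : MultiIndex d s, {f | mixedDeriv d α.1
        (Lp.toTemperedDistributionCLM ℂ volume 2 (f 0)) =
          Lp.toTemperedDistributionCLM ℂ volume 2 (f α)} := by
    ext f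
    simp [mem_sobolevSpace_iff, IsWeakDeriv]
  rw [h]
  have hc : ∀ α : MultiIndex d s,
      Continuous fun f : lp (fun _ : MultiIndex d s => L2 d) 2 => f α := fun α =>
    (lp.evalCLM ℂ (fun _ : MultiIndex d s => L2 d) 2 α).continuous
  refine isClosed_iInter fun α => isClosed_eq ?_ ?_
  · exact (mixedDeriv d α.1).continuous.comp
      ((Lp.toTemperedDistributionCLM ℂ volume 2).continuous.comp (hc 0))
  · exact (Lp.toTemperedDistributionCLM ℂ volume 2).continuous.comp (hc α)

instance (d : ℕ) (s : ℕ∞) : CompleteSpace (sobolevSpace d s) :=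
  (isClosed_sobolevSpace d s).completeSpace_coe

/-- The inner product of `W^s_2(ℝ^d)` (Mathlib's inner products are linear in the second
argument). -/
theorem sobolevSpace_inner {d : ℕ} {s : ℕ∞} (f g : sobolevSpace d s) :
    ⟪f, g⟫_ℂ = ∑' α : MultiIndex d s, ∫ x, g.1 α x * starRingEnd ℂ (f.1 α x) := by
  rw [Submodule.coe_inner, lp.inner_eq_tsum]
  simp [L2.inner_def]

/-- An `L₂` function belongs to `W^s_2(ℝ^d)` iff it has weak derivatives of all orders
`|α|₁ ≤ s` in `L₂(ℝ^d)`, with summable squared norms. -/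
theorem exists_mem_sobolevSpace_iff {d : ℕ} {s : ℕ∞} (u : L2 d) :
    (∃ f : sobolevSpace d s, toL2 f = u) ↔
      ∃ g : MultiIndex d s → L2 d, (∀ α, IsWeakDeriv α.1 u (g α)) ∧
        Summable fun α => ‖g α‖ ^ 2 := by
  constructor
  · rintro ⟨f, rfl⟩
    refine ⟨fun α => f.1 α, f.2, ?_⟩
    simpa using (lp.memℓp f.1).summable (by norm_num)
  · rintro ⟨g, hg, hs⟩
    have h0 : g 0 = u := by
      have hinj : Function.Injective (Lp.toTemperedDistributionCLM ℂ
          (volume : Measure (EuclideanSpace ℝ (Fin d))) 2) :=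
        LinearMap.ker_eq_bot.1 Lp.ker_toTemperedDistributionCLM_eq_bot
      apply hinj
      have h := hg 0
      have hz : ((0 : MultiIndex d s) : Fin d → ℕ) = 0 := rfl
      rw [IsWeakDeriv, hz] at h
      simpa [mixedDeriv] using h.symm
    refine ⟨⟨⟨g, memℓp_gen (by simpa using hs)⟩, fun α => ?_⟩, h0⟩
    have h := hg α
    rw [← h0] at h
    exact h

/-- An element of `W^s_2(ℝ^d)` is determined by its underlying `L₂` function. -/
theorem toL2_injective (d : ℕ) (s : ℕ∞) :
    Function.Injective (toL2 : sobolevSpace d s → L2 d) := by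
  intro f g h
  have hinj : Function.Injective (Lp.toTemperedDistributionCLM ℂ
      (volume : Measure (EuclideanSpace ℝ (Fin d))) 2) :=
    LinearMap.ker_eq_bot.1 Lp.ker_toTemperedDistributionCLM_eq_bot
  refine Subtype.ext (lp.ext (funext fun α => hinj ?_))
  have hf := (mem_sobolevSpace_iff f.1).1 f.2 α
  have hg := (mem_sobolevSpace_iff g.1).1 g.2 α
  simp only [IsWeakDeriv] at hf hg
  simp only [Lp.toTemperedDistributionCLM_apply]
  rw [← hf, ← hg]
  exact congrArg (fun u : L2 d => mixedDeriv d α.1 (u : 𝓢'(EuclideanSpace ℝ (Fin d), ℂ))) h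

/-- Weak derivatives through test functions:
`∫ f · D^α φ = (-1)^{|α|₁} ∫ g · φ`, where `D^α φ = ∂₁^{α₁} ⋯ ∂_d^{α_d} φ`. -/
theorem isWeakDeriv_iff {d : ℕ} (α : Fin d → ℕ) (f g : L2 d) :
    IsWeakDeriv α f g ↔ ∀ φ : 𝓢(EuclideanSpace ℝ (Fin d), ℂ),
      ∫ x, f x * ((List.finRange d).map fun j =>
        (LineDeriv.lineDerivOpCLM ℂ 𝓢(EuclideanSpace ℝ (Fin d), ℂ)
          (EuclideanSpace.single j (1 : ℝ))) ^ (α j)).prod φ x =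
      (-1) ^ (∑ j, α j) * ∫ x, g x * φ x := by
  have hcomm : ∀ i j : Fin d, Commute
      (LineDeriv.lineDerivOpCLM ℂ 𝓢(EuclideanSpace ℝ (Fin d), ℂ) (EuclideanSpace.single i (1 : ℝ)))
      (LineDeriv.lineDerivOpCLM ℂ 𝓢(EuclideanSpace ℝ (Fin d), ℂ)
        (EuclideanSpace.single j (1 : ℝ))) := by
    intro i j
    ext φ x
    have hd : ∀ v : EuclideanSpace ℝ (Fin d), ∀ y, (LineDeriv.lineDerivOpCLM ℂ
        𝓢(EuclideanSpace ℝ (Fin d), ℂ) v φ) y = fderiv ℝ φ y v := fun v y => rfl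
    have hdd : DifferentiableAt ℝ (fderiv ℝ φ) x :=
      ((φ.smooth 2).fderiv_right (m := 1) (by norm_num)).differentiable (by norm_num) x
    have h2 : ∀ v w : EuclideanSpace ℝ (Fin d), (LineDeriv.lineDerivOpCLM ℂ
        𝓢(EuclideanSpace ℝ (Fin d), ℂ) v (LineDeriv.lineDerivOpCLM ℂ
        𝓢(EuclideanSpace ℝ (Fin d), ℂ) w φ)) x = fderiv ℝ (fderiv ℝ φ) x v w := by
      intro v w
      change fderiv ℝ (fun y => fderiv ℝ φ y w) x v = _
      rw [fderiv_clm_apply hdd (differentiableAt_const w)]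
      simp
    simp only [FunLike.coe_mul_eq_comp, Function.comp_apply]
    rw [h2, h2]
    exact (φ.smooth 2).contDiffAt.isSymmSndFDerivAt (by simp) _ _
  have key : ∀ (l : List (Fin d)) (T : 𝓢'(EuclideanSpace ℝ (Fin d), ℂ))
      (φ : 𝓢(EuclideanSpace ℝ (Fin d), ℂ)),
      (l.map fun j => (LineDeriv.lineDerivOpCLM ℂ 𝓢'(EuclideanSpace ℝ (Fin d), ℂ)
        (EuclideanSpace.single j (1 : ℝ))) ^ (α j)).prod T φ =
      (-1) ^ (l.map α).sum * T ((l.map fun j => (LineDeriv.lineDerivOpCLM ℂ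
        𝓢(EuclideanSpace ℝ (Fin d), ℂ) (EuclideanSpace.single j (1 : ℝ))) ^ (α j)).prod φ) := by
    have hpow : ∀ (v : EuclideanSpace ℝ (Fin d)) (n : ℕ) (T : 𝓢'(EuclideanSpace ℝ (Fin d), ℂ))
        (φ : 𝓢(EuclideanSpace ℝ (Fin d), ℂ)),
        ((LineDeriv.lineDerivOpCLM ℂ 𝓢'(EuclideanSpace ℝ (Fin d), ℂ) v) ^ n) T φ =
        (-1) ^ n * T (((LineDeriv.lineDerivOpCLM ℂ 𝓢(EuclideanSpace ℝ (Fin d), ℂ) v) ^ n) φ) := by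
      intro v n
      induction n with
      | zero => intro T φ; simp
      | succ n ih =>
        intro T φ
        rw [pow_succ]
        simp only [FunLike.coe_mul_eq_comp, Function.comp_apply]
        rw [ih, pow_succ' (LineDeriv.lineDerivOpCLM ℂ 𝓢(EuclideanSpace ℝ (Fin d), ℂ) v)]
        simp only [FunLike.coe_mul_eq_comp, Function.comp_apply]
        change _ * T (- (LineDeriv.lineDerivOpCLM ℂ 𝓢(EuclideanSpace ℝ (Fin d), ℂ) v _)) = _
        rw [map_neg]
        ring
    intro l
    induction l with
    | nil => intro T φ; simp
    | cons j l ih =>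
      intro T φ
      have hc : Commute (LineDeriv.lineDerivOpCLM ℂ 𝓢(EuclideanSpace ℝ (Fin d), ℂ)
          (EuclideanSpace.single j (1 : ℝ)) ^ (α j))
          (l.map fun j => (LineDeriv.lineDerivOpCLM ℂ
            𝓢(EuclideanSpace ℝ (Fin d), ℂ) (EuclideanSpace.single j (1 : ℝ))) ^ (α j)).prod := by
        apply Commute.list_prod_right
        intro A hA
        obtain ⟨i, -, rfl⟩ := List.mem_map.1 hA
        exact (hcomm j i).pow_pow _ _
      simp only [List.map_cons, List.prod_cons, List.sum_cons]
      rw [hc.eq]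
      simp only [FunLike.coe_mul_eq_comp, Function.comp_apply]
      rw [hpow, ih, pow_add, mul_assoc]
  have hsum : ((List.finRange d).map α).sum = ∑ j, α j := by
    rw [← List.ofFn_eq_map, List.sum_ofFn]
  have hsq : ((-1 : ℂ) ^ (∑ j, α j)) * (-1) ^ (∑ j, α j) = 1 := by
    rw [← mul_pow]; simp
  constructor
  · intro h φ
    have h1 := DFunLike.congr_fun h φ
    rw [mixedDeriv, key, hsum] at h1
    simp only [Lp.toTemperedDistribution_apply, smul_eq_mul] at h1
    simp only [mul_comm (g _), mul_comm (f _), ← h1, ← mul_assoc, hsq, one_mul]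
  · intro h
    ext φ
    rw [mixedDeriv, key, hsum]
    have h1 := h φ
    simp only [Lp.toTemperedDistribution_apply, smul_eq_mul]
    simp only [mul_comm (g _), mul_comm (f _)] at h1
    rw [h1, ← mul_assoc, hsq, one_mul]

/-- The nonzero multi-indices `α ∈ ℕ^d` with `0 < |α|₁ ≤ s`, for finite `s`. -/
def nonzeroMultiIndices (d s : ℕ) : Finset (Fin d → ℕ) :=
  (Fintype.piFinset fun _ => Finset.range (s + 1)).filter
    fun α => 0 < ∑ j, α j ∧ ∑ j, α j ≤ s

theorem mem_nonzeroMultiIndices {d s : ℕ} (α : Fin d → ℕ) :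
    α ∈ nonzeroMultiIndices d s ↔ 0 < ∑ j, α j ∧ ∑ j, α j ≤ s := by
  simp only [nonzeroMultiIndices, Finset.mem_filter, Fintype.mem_piFinset, Finset.mem_range,
    and_iff_right_iff_imp]
  rintro ⟨-, h⟩ j
  exact Nat.lt_succ_of_le ((Finset.single_le_sum (fun _ _ => Nat.zero_le _)
    (Finset.mem_univ j)).trans h)

/-- The integrand of the formula for the kernel `K_{d,s}(x,t)`. -/
def kernelIntegrand (d s : ℕ) (x t u : EuclideanSpace ℝ (Fin d)) : ℂ :=
  Complex.exp (2 * Real.pi * Complex.I * ((∑ j, (x j - t j) * u j : ℝ) : ℂ)) /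
    ((1 + ∑ α ∈ nonzeroMultiIndices d s, ∏ j, (2 * Real.pi * u j) ^ (2 * α j) : ℝ) : ℂ)

/-- The function `2 (sin z - z cos z) / (π z³)`, extended continuously to `z = 0`. -/
def varenna (z : ℝ) : ℝ :=
  if z = 0 then 2 / (3 * Real.pi)
  else 2 / (Real.pi * z ^ 3) * (Real.sin z - z * Real.cos z)

end SobolevKernel

end

noncomputable section

namespace SobolevKernel

open scoped FourierTransform

/-! Under the Fourier transform, D^α becomes multiplication by `symbol α`, so by Plancherel and
Tonelli the squared Sobolev norm of f is the integral of `sqSum` · |f̂|²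
(`lintegral_sqSum_mul_hat`). The function with transform e^{-2πi u·t} · `weight`, where `weight` =
1/`sqSum`, therefore pairs with f to give the integral of f̂(u) e^{2πi u·t}, which is f(t) by
Fourier inversion (`inner_eq_fourierInv_hat`).

All of this needs only that `weight` be integrable: then f̂ is integrable, f has a continuous
representative, and the kernel is the inverse transform of the weight at x - t (`exists_rkhs`). This
argument treats finite and infinite s together.

For finite s > d/2 the weight is the reciprocal of a polynomial that dominates (1 + |u|)^{2s} up to
a constant. For s = ∞ the sum over all multi-indices is a product of geometric series, so the weight
is the compactly supported product of the factors max(1 - (2πu_j)², 0) (`weight_top`), and the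
kernel is a product of one-dimensional elementary integrals. -/

/-- The Fourier symbol `∏ (2πi u_j)^{α_j}` of the mixed derivative `D^α`. -/
def symbol {d : ℕ} (α : Fin d → ℕ) (u : EuclideanSpace ℝ (Fin d)) : ℂ :=
  ∏ j, (2 * Real.pi * Complex.I * (u j : ℂ)) ^ α j

/-! ### Mixed derivatives as Fourier multipliers -/

theorem hasTemperateGrowth_symbol_factor {d : ℕ} (j : Fin d) (n : ℕ) :
    (fun u : EuclideanSpace ℝ (Fin d) =>
      (2 * Real.pi * Complex.I * (u j : ℂ)) ^ n).HasTemperateGrowth := by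
  have h : (fun u : EuclideanSpace ℝ (Fin d) =>
      2 * Real.pi * Complex.I * (u j : ℂ)).HasTemperateGrowth := by
    have h1 : (fun u : EuclideanSpace ℝ (Fin d) =>
        ((EuclideanSpace.proj j : EuclideanSpace ℝ (Fin d) →L[ℝ] ℝ) u : ℂ)).HasTemperateGrowth := by
      fun_prop
    exact (Function.HasTemperateGrowth.const _).mul h1
  induction n with
  | zero => simp
  | succ n ih =>
    simp only [pow_succ]
    exact ih.mul h

theorem hasTemperateGrowth_symbol_list {d : ℕ} (α : Fin d → ℕ) (l : List (Fin d)) :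
    (fun u : EuclideanSpace ℝ (Fin d) =>
      (l.map fun j => (2 * Real.pi * Complex.I * (u j : ℂ)) ^ α j).prod).HasTemperateGrowth := by
  induction l with
  | nil => simp
  | cons j l ih =>
    simp only [List.map_cons, List.prod_cons]
    exact (hasTemperateGrowth_symbol_factor j (α j)).mul ih

theorem symbol_eq_list_prod {d : ℕ} (α : Fin d → ℕ) :
    symbol α = fun u => ((List.finRange d).map fun j =>
      (2 * Real.pi * Complex.I * (u j : ℂ)) ^ α j).prod := by
  funext u
  rw [symbol, ← List.ofFn_eq_map, List.prod_ofFn]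

theorem hasTemperateGrowth_symbol {d : ℕ} (α : Fin d → ℕ) :
    (symbol α).HasTemperateGrowth := by
  rw [symbol_eq_list_prod]
  exact hasTemperateGrowth_symbol_list α _

theorem continuous_symbol {d : ℕ} (α : Fin d → ℕ) : Continuous (symbol α) := by
  unfold symbol
  fun_prop

theorem fourier_lineDerivOp_single {d : ℕ} (j : Fin d) (T : 𝓢'(EuclideanSpace ℝ (Fin d), ℂ)) :
    𝓕 (LineDeriv.lineDerivOpCLM ℂ 𝓢'(EuclideanSpace ℝ (Fin d), ℂ)
      (EuclideanSpace.single j (1 : ℝ)) T) =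
    TemperedDistribution.smulLeftCLM ℂ (fun u : EuclideanSpace ℝ (Fin d) =>
      (2 * Real.pi * Complex.I * (u j : ℂ))) (𝓕 T) := by
  have h1 := TemperedDistribution.fourier_lineDerivOp_eq T (EuclideanSpace.single j (1 : ℝ))
  have hg : (fun u : EuclideanSpace ℝ (Fin d) =>
      ((inner ℝ u (EuclideanSpace.single j (1 : ℝ)) : ℝ) : ℂ)).HasTemperateGrowth := by fun_prop
  rw [LineDeriv.lineDerivOpCLM_apply, h1]
  have h2 := DFunLike.congr_fun (TemperedDistribution.smulLeftCLM_smul (F := ℂ) hg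
    (2 * Real.pi * Complex.I)) (𝓕 T)
  refine Eq.trans h2.symm ?_
  congr 2
  funext u
  simp [EuclideanSpace.inner_single_right]

theorem fourier_lineDerivOp_pow {d : ℕ} (j : Fin d) (n : ℕ)
    (T : 𝓢'(EuclideanSpace ℝ (Fin d), ℂ)) :
    𝓕 (((LineDeriv.lineDerivOpCLM ℂ 𝓢'(EuclideanSpace ℝ (Fin d), ℂ)
      (EuclideanSpace.single j (1 : ℝ))) ^ n) T) =
    TemperedDistribution.smulLeftCLM ℂ (fun u : EuclideanSpace ℝ (Fin d) =>
      (2 * Real.pi * Complex.I * (u j : ℂ)) ^ n) (𝓕 T) := by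
  induction n with
  | zero => simp
  | succ n ih =>
    have h1 := hasTemperateGrowth_symbol_factor j 1
    simp only [pow_one] at h1
    rw [pow_succ', FunLike.coe_mul_eq_comp, Function.comp_apply, fourier_lineDerivOp_single, ih,
      TemperedDistribution.smulLeftCLM_smulLeftCLM_apply (hasTemperateGrowth_symbol_factor j n) h1]
    congr 2

theorem fourier_mixedDeriv {d : ℕ} (α : Fin d → ℕ) (T : 𝓢'(EuclideanSpace ℝ (Fin d), ℂ)) :
    𝓕 (mixedDeriv d α T) = TemperedDistribution.smulLeftCLM ℂ (symbol α) (𝓕 T) := by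
  rw [symbol_eq_list_prod, mixedDeriv]
  induction List.finRange d with
  | nil => simp
  | cons j l ih =>
    simp only [List.map_cons, List.prod_cons]
    rw [FunLike.coe_mul_eq_comp, Function.comp_apply, fourier_lineDerivOp_pow, ih,
      TemperedDistribution.smulLeftCLM_smulLeftCLM_apply (hasTemperateGrowth_symbol_list α l)
        (hasTemperateGrowth_symbol_factor j (α j))]
    congr 2
    funext u
    simp [mul_comm]

/-- Real-valued smooth functions of compact support, viewed as complex-valued, are Schwartz
functions, so this reduces to the fundamental lemma of the calculus of variations. -/
theorem ae_eq_of_integral_schwartz_smul_eq {d : ℕ} {f g : EuclideanSpace ℝ (Fin d) → ℂ}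
    (hf : LocallyIntegrable f) (hg : LocallyIntegrable g)
    (h : ∀ φ : 𝓢(EuclideanSpace ℝ (Fin d), ℂ), ∫ x, φ x • f x = ∫ x, φ x • g x) :
    f =ᵐ[volume] g := by
  refine ae_eq_of_integral_contDiff_smul_eq hf hg fun φ hφ hc => ?_
  have hg₁ : HasCompactSupport (Complex.ofRealCLM ∘ φ) := hc.comp_left rfl
  have hg₂ : ContDiff ℝ (↑(⊤ : ℕ∞)) (Complex.ofRealCLM ∘ φ) := by fun_prop
  simpa using h (hg₁.toSchwartzMap hg₂)

/-- The Fourier transform is injective on tempered distributions. The product `symbol α` · f̂ is not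
known in advance to lie in L₂, but it is locally integrable, which is enough to compare it with ĝ
through test functions. -/
theorem isWeakDeriv_iff_fourier {d : ℕ} (α : Fin d → ℕ) (f g : L2 d) :
    IsWeakDeriv α f g ↔ (𝓕 g : L2 d) =ᵐ[volume] fun u => symbol α u * (𝓕 f : L2 d) u := by
  have hinj : Function.Injective
      (𝓕 : 𝓢'(EuclideanSpace ℝ (Fin d), ℂ) → 𝓢'(EuclideanSpace ℝ (Fin d), ℂ)) :=
    Function.LeftInverse.injective (g := 𝓕⁻) fun T => FourierTransform.fourierInv_fourier_eq T
  rw [IsWeakDeriv, ← hinj.eq_iff, fourier_mixedDeriv, Lp.fourier_toTemperedDistribution_eq,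
    Lp.fourier_toTemperedDistribution_eq]
  have key : ∀ φ : 𝓢(EuclideanSpace ℝ (Fin d), ℂ),
      TemperedDistribution.smulLeftCLM ℂ (symbol α) ((𝓕 f : L2 d) : 𝓢'(_, ℂ)) φ =
        ∫ u, φ u • (symbol α u * (𝓕 f : L2 d) u) := by
    intro φ
    rw [TemperedDistribution.smulLeftCLM_apply_apply, Lp.toTemperedDistribution_apply]
    congr 1
    funext u
    rw [SchwartzMap.smulLeftCLM_apply_apply (hasTemperateGrowth_symbol α)]
    simp only [smul_eq_mul]
    ring
  constructor
  · intro h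
    refine ae_eq_of_integral_schwartz_smul_eq ((Lp.memLp _).locallyIntegrable (by norm_num)) ?_ ?_
    · have h1 : LocallyIntegrable (fun u => (𝓕 f : L2 d) u) volume :=
        (Lp.memLp _).locallyIntegrable (by norm_num)
      exact h1.continuous_mul (continuous_symbol α)
    · intro φ
      rw [← key, h, Lp.toTemperedDistribution_apply]
  · intro h
    ext φ
    rw [key, Lp.toTemperedDistribution_apply]
    refine integral_congr_ae ?_
    filter_upwards [h] with u hu
    rw [hu]

/-! ### Fourier inversion on L₁ ∩ L₂ -/

theorem continuous_fourierInv_of_integrable {d : ℕ} {h : EuclideanSpace ℝ (Fin d) → ℂ}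
    (hh : Integrable h) : Continuous (𝓕⁻ h) := by
  have h1 : Continuous (𝓕 h) :=
    VectorFourier.fourierIntegral_continuous Real.continuous_fourierChar
      (innerSL ℝ).continuous₂ hh
  have h2 : 𝓕⁻ h = fun x => 𝓕 h (-x) := funext fun x => Real.fourierInv_eq_fourier_neg h x
  rw [h2]
  exact h1.comp continuous_neg

theorem integral_fourier_smul_eq_of_integrable {d : ℕ} {g h : EuclideanSpace ℝ (Fin d) → ℂ}
    (hg : Integrable g) (hh : Integrable h) :
    ∫ x, 𝓕 g x • h x = ∫ x, g x • 𝓕 h x := by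
  simpa using! (VectorFourier.integral_fourierIntegral_smul_eq_flip (L := innerₗ _)
      Real.continuous_fourierChar continuous_inner hg hh)

/-- On `L₁ ∩ L₂` the inverse Fourier transform of `L₂` is given by the integral formula. -/
theorem fourierInv_ae_eq {d : ℕ} (h : L2 d) (hh : Integrable (h : EuclideanSpace ℝ (Fin d) → ℂ)) :
    𝓕⁻ (h : EuclideanSpace ℝ (Fin d) → ℂ) =ᵐ[volume] (𝓕⁻ h : L2 d) := by
  have hc := continuous_fourierInv_of_integrable hh
  refine ae_eq_of_integral_schwartz_smul_eq hc.locallyIntegrable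
    ((Lp.memLp _).locallyIntegrable (by norm_num)) fun φ => ?_
  -- Both inverse transforms of `h` are tested against φ: here the L₂ one is moved onto φ by
  -- duality, and below the integral one by the multiplication formula applied to y ↦ h(-y).
  have h1 : ∫ x, φ x • (𝓕⁻ h : L2 d) x = ∫ x, (𝓕⁻ φ) x • h x := by
    rw [← Lp.toTemperedDistribution_apply, ← Lp.toTemperedDistribution_apply,
      ← Lp.fourierInv_toTemperedDistribution_eq, TemperedDistribution.fourierInv_apply]
  rw [h1]
  have h3 := integral_fourier_smul_eq_of_integrable φ.integrable hh.comp_neg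
  have h4 : ∀ x, 𝓕 (fun y => h (-y)) x = 𝓕⁻ (h : EuclideanSpace ℝ (Fin d) → ℂ) x := fun x => by
    rw [Real.fourierInv_eq_fourier_comp_neg]
  simp only [h4] at h3
  rw [← h3, ← integral_neg_eq_self]
  simp only [neg_neg]
  congr 1

/-! ### The weight -/

/-- The sum `∑_{|α|₁ ≤ s} ∏ (2πu_j)^{2α_j}`, possibly infinite. -/
def sqSum (d : ℕ) (s : ℕ∞) (u : EuclideanSpace ℝ (Fin d)) : ℝ≥0∞ :=
  ∑' α : MultiIndex d s, ‖symbol α.1 u‖ₑ ^ 2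

/-- The Fourier transform of the reproducing kernel, the reciprocal of `sqSum`; it vanishes where
`sqSum` is infinite. -/
def weight (d : ℕ) (s : ℕ∞) (u : EuclideanSpace ℝ (Fin d)) : ℝ≥0∞ := (sqSum d s u)⁻¹

section weight

variable {d : ℕ} {s : ℕ∞}

theorem measurable_sqSum : Measurable (sqSum d s) :=
  Measurable.tsum fun α => ((continuous_symbol α.1).enorm.measurable.pow_const 2)

theorem measurable_weight : Measurable (weight d s) := measurable_sqSum.inv

theorem one_le_sqSum (u : EuclideanSpace ℝ (Fin d)) : 1 ≤ sqSum d s u := by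
  refine le_trans ?_ (ENNReal.le_tsum (0 : MultiIndex d s))
  have hz : ((0 : MultiIndex d s) : Fin d → ℕ) = 0 := rfl
  simp [symbol, hz]

theorem sqSum_ne_zero (u : EuclideanSpace ℝ (Fin d)) : sqSum d s u ≠ 0 :=
  (zero_lt_one.trans_le (one_le_sqSum u)).ne'

theorem weight_le_one (u : EuclideanSpace ℝ (Fin d)) : weight d s u ≤ 1 :=
  ENNReal.inv_le_one.2 (one_le_sqSum u)

theorem weight_ne_top (u : EuclideanSpace ℝ (Fin d)) : weight d s u ≠ ⊤ :=
  ne_top_of_le_ne_top ENNReal.one_ne_top (weight_le_one u)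

theorem sqSum_mul_weight_le_one (u : EuclideanSpace ℝ (Fin d)) :
    sqSum d s u * weight d s u ≤ 1 := ENNReal.mul_inv_le_one _

end weight

/-! ### The Sobolev norm on the Fourier side -/

theorem lintegral_enorm_sq_eq {d : ℕ} (f : L2 d) : ∫⁻ u, ‖f u‖ₑ ^ 2 = ‖f‖ₑ ^ 2 := by
  rw [Lp.enorm_def, eLpNorm_eq_lintegral_rpow_enorm_toReal (by norm_num) (by norm_num)]
  rw [← ENNReal.rpow_natCast, ← ENNReal.rpow_mul]
  simp

theorem summable_norm_sq_iff_tsum_enorm_sq {ι E : Type*} [NormedAddCommGroup E] (f : ι → E) :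
    (Summable fun i => ‖f i‖ ^ 2) ↔ ∑' i, ‖f i‖ₑ ^ 2 ≠ ⊤ := by
  have h : ∀ i, ‖f i‖ₑ ^ 2 = ((‖f i‖₊ ^ 2 : NNReal) : ℝ≥0∞) := fun i => by
    rw [ENNReal.coe_pow]; rfl
  simp only [h]
  rw [ENNReal.tsum_coe_ne_top_iff_summable, ← NNReal.summable_coe]
  simp

section transform

variable {d : ℕ} {s : ℕ∞}

/-- The Fourier transform of the function underlying an element of the Sobolev space. -/
def hat (f : sobolevSpace d s) : L2 d := 𝓕 (toL2 f)

theorem fourier_component_ae_eq (f : sobolevSpace d s) (α : MultiIndex d s) :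
    (𝓕 (f.1 α) : L2 d) =ᵐ[volume] fun u => symbol α.1 u * hat f u :=
  (isWeakDeriv_iff_fourier α.1 _ _).1 (f.2 α)

theorem tsum_enorm_sq_ne_top (f : sobolevSpace d s) : ∑' α, ‖f.1 α‖ₑ ^ 2 ≠ ⊤ := by
  rw [← summable_norm_sq_iff_tsum_enorm_sq]
  simpa using (lp.memℓp f.1).summable (by norm_num)

/-- Plancherel in each component, then Tonelli. Working in `ℝ≥0∞` allows `sqSum` to be infinite, as
happens for s = ∞. -/
theorem lintegral_sqSum_mul_hat (f : sobolevSpace d s) :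
    ∫⁻ u, sqSum d s u * ‖hat f u‖ₑ ^ 2 = ∑' α, ‖f.1 α‖ₑ ^ 2 := by
  have h : ∀ α : MultiIndex d s, ‖f.1 α‖ₑ ^ 2 = ∫⁻ u, ‖symbol α.1 u‖ₑ ^ 2 * ‖hat f u‖ₑ ^ 2 := by
    intro α
    have h1 : ‖f.1 α‖ₑ = ‖(𝓕 (f.1 α) : L2 d)‖ₑ := by
      rw [← ofReal_norm, ← ofReal_norm, Lp.norm_fourier_eq]
    rw [h1, ← lintegral_enorm_sq_eq]
    refine lintegral_congr_ae ?_
    filter_upwards [fourier_component_ae_eq f α] with u hu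
    rw [hu, enorm_mul, mul_pow]
  simp only [h]
  rw [← lintegral_tsum]
  · simp only [ENNReal.tsum_mul_right, sqSum]
  · intro α
    exact ((continuous_symbol α.1).enorm.measurable.pow_const 2).aemeasurable.mul
      ((Lp.aestronglyMeasurable _).enorm.pow_const 2)

theorem ae_sqSum_mul_hat_ne_top (f : sobolevSpace d s) :
    ∀ᵐ u, sqSum d s u * ‖hat f u‖ₑ ^ 2 ≠ ⊤ := by
  have h : ∫⁻ u, sqSum d s u * ‖hat f u‖ₑ ^ 2 ≠ ⊤ := by
    rw [lintegral_sqSum_mul_hat]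
    exact tsum_enorm_sq_ne_top f
  filter_upwards [ae_lt_top' (measurable_sqSum.aemeasurable.mul
    ((Lp.aestronglyMeasurable _).enorm.pow_const 2)) h] with u hu using hu.ne

/-- This makes the value 0 of `weight` harmless at frequencies where `sqSum` is infinite: no element
of the space has any mass there. -/
theorem ae_hat_eq_zero_of_sqSum_eq_top (f : sobolevSpace d s) :
    ∀ᵐ u, sqSum d s u = ⊤ → hat f u = 0 := by
  filter_upwards [ae_sqSum_mul_hat_ne_top f] with u hu htop
  by_contra h0
  refine hu ?_
  rw [htop, ENNReal.top_mul]
  simpa using h0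

theorem integrable_hat (hw : ∫⁻ u, weight d s u ≠ ⊤) (f : sobolevSpace d s) :
    Integrable (hat f : EuclideanSpace ℝ (Fin d) → ℂ) := by
  refine ⟨Lp.aestronglyMeasurable _, ?_⟩
  -- A pointwise substitute for Cauchy–Schwarz: with w = `weight`, either a ≤ w, or w ≤ a and then a
  -- = w⁻¹ · (w a) ≤ w⁻¹ a².
  have h1 : ∀ᵐ u, ‖hat f u‖ₑ ≤ weight d s u + sqSum d s u * ‖hat f u‖ₑ ^ 2 := by
    filter_upwards [ae_hat_eq_zero_of_sqSum_eq_top f] with u hu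
    by_cases htop : sqSum d s u = ⊤
    · simp [hu htop]
    set a := ‖hat f u‖ₑ
    rcases le_total a (weight d s u) with h | h
    · exact h.trans le_self_add
    · refine le_trans ?_ le_add_self
      calc a = sqSum d s u * (weight d s u * a) := by
            rw [← mul_assoc, weight, ENNReal.mul_inv_cancel (sqSum_ne_zero u) htop, one_mul]
        _ ≤ sqSum d s u * a ^ 2 := by rw [sq]; gcongr
  refine (lintegral_mono_ae h1).trans_lt ?_
  rw [lintegral_add_left measurable_weight, lintegral_sqSum_mul_hat]
  exact ENNReal.add_lt_top.2 ⟨hw.lt_top, (tsum_enorm_sq_ne_top f).lt_top⟩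

end transform

/-! ### The reproducing kernel as the inverse transform of the weight -/

section kernel

variable {d : ℕ} {s : ℕ∞}

/-- The Fourier transform of the kernel function at `t`. -/
def kernelHat (d : ℕ) (s : ℕ∞) (t u : EuclideanSpace ℝ (Fin d)) : ℂ :=
  (Real.fourierChar (-inner ℝ u t) : ℂ) * ((weight d s u).toReal : ℂ)

theorem measurable_kernelHat (t : EuclideanSpace ℝ (Fin d)) : Measurable (kernelHat d s t) := by
  have h : Continuous fun u : EuclideanSpace ℝ (Fin d) =>
      (Real.fourierChar (-inner ℝ u t) : ℂ) :=
    continuous_subtype_val.comp (Real.continuous_fourierChar.comp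
      (continuous_id.inner continuous_const).neg)
  exact h.measurable.mul (Complex.measurable_ofReal.comp measurable_weight.ennreal_toReal)

theorem enorm_kernelHat (t u : EuclideanSpace ℝ (Fin d)) : ‖kernelHat d s t u‖ₑ = weight d s u := by
  rw [kernelHat, enorm_mul]
  have h1 : ‖(Real.fourierChar (-inner ℝ u t) : ℂ)‖ₑ = 1 := by
    rw [← ofReal_norm, Circle.norm_coe, ENNReal.ofReal_one]
  rw [h1, one_mul, ← ofReal_norm, Complex.norm_of_nonneg ENNReal.toReal_nonneg,
    ENNReal.ofReal_toReal (weight_ne_top u)]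

theorem integrable_kernelHat (hw : ∫⁻ u, weight d s u ≠ ⊤) (t : EuclideanSpace ℝ (Fin d)) :
    Integrable (kernelHat d s t) := by
  refine ⟨(measurable_kernelHat t).aestronglyMeasurable, ?_⟩
  simp only [HasFiniteIntegral, enorm_kernelHat]
  exact hw.lt_top

/-- The candidate kernel function has finite Sobolev norm because `sqSum` · `weight`² ≤ `weight`;
the inequality survives where `sqSum` is infinite. -/
theorem tsum_lintegral_symbol_mul_kernelHat (hw : ∫⁻ u, weight d s u ≠ ⊤)
    (t : EuclideanSpace ℝ (Fin d)) :
    ∑' α : MultiIndex d s, ∫⁻ u, ‖symbol α.1 u * kernelHat d s t u‖ₑ ^ 2 ≠ ⊤ := by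
  rw [← lintegral_tsum]
  · refine ne_top_of_le_ne_top hw (lintegral_mono fun u => ?_)
    simp only [enorm_mul, mul_pow, ENNReal.tsum_mul_right, enorm_kernelHat]
    change sqSum d s u * weight d s u ^ 2 ≤ weight d s u
    rw [sq, ← mul_assoc]
    exact mul_le_of_le_one_left' (sqSum_mul_weight_le_one u)
  · intro α
    exact (((continuous_symbol α.1).measurable.mul
      (measurable_kernelHat t)).enorm.pow_const 2).aemeasurable

theorem memLp_symbol_mul_kernelHat (hw : ∫⁻ u, weight d s u ≠ ⊤) (t : EuclideanSpace ℝ (Fin d))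
    (α : MultiIndex d s) : MemLp (fun u => symbol α.1 u * kernelHat d s t u) 2 := by
  refine ⟨((continuous_symbol α.1).measurable.mul
      (measurable_kernelHat t)).aestronglyMeasurable, ?_⟩
  rw [eLpNorm_lt_top_iff_lintegral_rpow_enorm_lt_top (by norm_num) (by norm_num)]
  have h := ENNReal.ne_top_of_tsum_ne_top (tsum_lintegral_symbol_mul_kernelHat hw t) α
  simpa using h.lt_top

/-- The kernel function at `t`, as an element of the Sobolev space. -/
theorem exists_kernelElement (hw : ∫⁻ u, weight d s u ≠ ⊤) (t : EuclideanSpace ℝ (Fin d)) :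
    ∃ k : sobolevSpace d s, hat k =ᵐ[volume] kernelHat d s t := by
  have hz : ((0 : MultiIndex d s) : Fin d → ℕ) = 0 := rfl
  set g : MultiIndex d s → L2 d := fun α => 𝓕⁻ (memLp_symbol_mul_kernelHat hw t α).toLp with hg
  have hFg : ∀ α, (𝓕 (g α) : L2 d) =ᵐ[volume] fun u => symbol α.1 u * kernelHat d s t u := by
    intro α
    simp only [hg, FourierTransform.fourier_fourierInv_eq]
    exact MemLp.coeFn_toLp _
  have h0 : (𝓕 (g 0) : L2 d) =ᵐ[volume] kernelHat d s t := by
    filter_upwards [hFg 0] with u hu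
    rw [hu, hz]
    simp [symbol]
  have hsum : Summable fun α => ‖g α‖ ^ 2 := by
    rw [summable_norm_sq_iff_tsum_enorm_sq]
    convert tsum_lintegral_symbol_mul_kernelHat hw t with α
    have h1 : ‖g α‖ₑ = ‖(𝓕 (g α) : L2 d)‖ₑ := by
      rw [← ofReal_norm, ← ofReal_norm, Lp.norm_fourier_eq]
    rw [h1, ← lintegral_enorm_sq_eq]
    refine lintegral_congr_ae ?_
    filter_upwards [hFg α] with u hu
    rw [hu]
  obtain ⟨k, hk⟩ := (exists_mem_sobolevSpace_iff (s := s) (g 0)).2 ⟨g, fun α => by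
    rw [isWeakDeriv_iff_fourier]
    filter_upwards [hFg α, h0] with u h1 h2
    rw [h1, h2], hsum⟩
  exact ⟨k, by rw [hat, hk]; exact h0⟩

/-- The reproducing property: summed over α, the factors |`symbol α`|² cancel the weight in
`kernelHat`, and only f̂ times a character remains. -/
theorem inner_eq_fourierInv_hat (hw : ∫⁻ u, weight d s u ≠ ⊤) (t : EuclideanSpace ℝ (Fin d))
    (k f : sobolevSpace d s) (hk : hat k =ᵐ[volume] kernelHat d s t) :
    ⟪k, f⟫_ℂ = 𝓕⁻ (hat f : EuclideanSpace ℝ (Fin d) → ℂ) t := by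
  have h1 : ∀ α : MultiIndex d s, ⟪k.1 α, f.1 α⟫_ℂ = ∫ u, ((‖symbol α.1 u‖ ^ 2 : ℝ) : ℂ) *
      (hat f u * starRingEnd ℂ (kernelHat d s t u)) := by
    intro α
    rw [← Lp.inner_fourier_eq, L2.inner_def]
    refine integral_congr_ae ?_
    filter_upwards [hk, fourier_component_ae_eq k α, fourier_component_ae_eq f α] with u h1 h2 h3
    rw [h2, h3, h1, RCLike.inner_apply, map_mul, Complex.ofReal_pow, ← Complex.mul_conj']
    ring
  rw [Submodule.coe_inner, lp.inner_eq_tsum]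
  simp only [h1]
  -- Sum and integral may be exchanged because the summed absolute values are at most |f̂|, which is
  -- integrable.
  rw [← integral_tsum]
  · rw [Real.fourierInv_eq]
    refine integral_congr_ae ?_
    filter_upwards [ae_hat_eq_zero_of_sqSum_eq_top f] with u hu
    -- The cancellation `sqSum` · `weight` = 1 fails where `sqSum` is infinite, but f̂ vanishes
    -- there.
    by_cases htop : sqSum d s u = ⊤
    · simp [hu htop]
    have h2 : ∑' α : MultiIndex d s, ‖symbol α.1 u‖ ^ 2 = (sqSum d s u).toReal := by
      rw [sqSum, ENNReal.tsum_toReal_eq (ENNReal.ne_top_of_tsum_ne_top htop)]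
      simp
    have h3 : (sqSum d s u).toReal * (weight d s u).toReal = 1 := by
      rw [← ENNReal.toReal_mul, weight, ENNReal.mul_inv_cancel (sqSum_ne_zero u) htop,
        ENNReal.toReal_one]
    rw [tsum_mul_right, ← Complex.ofReal_tsum, h2, kernelHat, map_mul, Complex.conj_ofReal,
      AddChar.map_neg_eq_inv, ← Circle.coe_inv_eq_conj, inv_inv, Circle.smul_def, smul_eq_mul]
    have h4 : ((sqSum d s u).toReal : ℂ) * ((weight d s u).toReal : ℂ) = 1 := by
      exact_mod_cast h3
    linear_combination (hat f u * (Real.fourierChar (inner ℝ u t) : ℂ)) * h4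
  · intro α
    exact (((Complex.continuous_ofReal.comp
      ((continuous_symbol α.1).norm.pow 2)).aestronglyMeasurable).mul
      ((Lp.aestronglyMeasurable _).mul
        (Complex.continuous_conj.comp_aestronglyMeasurable
          (measurable_kernelHat t).aestronglyMeasurable)))
  · rw [← lintegral_tsum]
    · refine ne_top_of_le_ne_top (integrable_hat hw f).2.ne (lintegral_mono fun u => ?_)
      have h2 : ∀ α : MultiIndex d s, ‖((‖symbol α.1 u‖ ^ 2 : ℝ) : ℂ) *
          (hat f u * starRingEnd ℂ (kernelHat d s t u))‖ₑ =
          ‖symbol α.1 u‖ₑ ^ 2 * (‖hat f u‖ₑ * weight d s u) := by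
        intro α
        rw [enorm_mul, enorm_mul, RCLike.enorm_conj, enorm_kernelHat, ← ofReal_norm,
          Complex.norm_of_nonneg (by positivity), ENNReal.ofReal_pow (norm_nonneg _), ofReal_norm]
      simp only [h2, ENNReal.tsum_mul_right]
      calc sqSum d s u * (‖hat f u‖ₑ * weight d s u)
          = (sqSum d s u * weight d s u) * ‖hat f u‖ₑ := by ring
        _ ≤ ‖hat f u‖ₑ := mul_le_of_le_one_left' (sqSum_mul_weight_le_one u)
    · intro α
      refine AEMeasurable.enorm ?_
      exact (((Complex.continuous_ofReal.comp
        ((continuous_symbol α.1).norm.pow 2)).aestronglyMeasurable).mul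
        ((Lp.aestronglyMeasurable _).mul
          (Complex.continuous_conj.comp_aestronglyMeasurable
            (measurable_kernelHat t).aestronglyMeasurable))).aemeasurable

/-- If the weight is integrable, the Sobolev space is a reproducing kernel Hilbert space of
continuous functions, and its kernel is the inverse Fourier transform of the weight. -/
theorem exists_rkhs (hw : ∫⁻ u, weight d s u ≠ ⊤) :
    ∃ R : RKHS ℂ (sobolevSpace d s) (EuclideanSpace ℝ (Fin d)) ℂ,
      (∀ f : sobolevSpace d s, Continuous (R.coeCLM f) ∧ R.coeCLM f =ᵐ[volume] toL2 f) ∧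
      ∀ x t : EuclideanSpace ℝ (Fin d),
        RKHS.kernel (sobolevSpace d s) x t 1 =
          ∫ u, (Real.fourierChar (inner ℝ u (x - t)) : ℂ) * ((weight d s u).toReal : ℂ) := by
  choose k hk using exists_kernelElement (s := s) hw
  set ev : sobolevSpace d s →L[ℂ] EuclideanSpace ℝ (Fin d) → ℂ :=
    ContinuousLinearMap.pi fun t => innerSL ℂ (k t) with hev
  have hev_apply : ∀ f t, ev f t = ⟪k t, f⟫_ℂ := fun f t => by simp [hev]
  have hev_eq : ∀ f, ev f = 𝓕⁻ (hat f : EuclideanSpace ℝ (Fin d) → ℂ) := fun f =>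
    funext fun t => by rw [hev_apply, inner_eq_fourierInv_hat hw t (k t) f (hk t)]
  have hev_ae : ∀ f, ev f =ᵐ[volume] toL2 f := fun f => by
    rw [hev_eq]
    refine (fourierInv_ae_eq (hat f) (integrable_hat hw f)).trans ?_
    rw [hat, FourierTransform.fourierInv_fourier_eq]
  -- An element is recovered from its point values, since `ev f` represents the L₂ class that
  -- determines f.
  have hinj : Function.Injective (ev : sobolevSpace d s → EuclideanSpace ℝ (Fin d) → ℂ) := by
    intro f g h
    refine toL2_injective d s (Lp.ext ?_)
    exact (hev_ae f).symm.trans (by rw [h]; exact hev_ae g)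
  let R : RKHS ℂ (sobolevSpace d s) (EuclideanSpace ℝ (Fin d)) ℂ := ⟨ev, hinj⟩
  refine ⟨R, fun f => ⟨?_, hev_ae f⟩, fun x t => ?_⟩
  · change Continuous (ev f)
    rw [hev_eq]
    exact continuous_fourierInv_of_integrable (integrable_hat hw f)
  · have h1 : RKHS.kerFun (sobolevSpace d s) t 1 = k t := by
      refine ext_inner_right ℂ fun f => ?_
      rw [RKHS.kerFun_inner, ← hev_apply]
      change ⟪(1 : ℂ), ev f t⟫_ℂ = _
      simp
    rw [← RKHS.kerFun_apply, h1]
    change ev (k t) x = _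
    rw [hev_eq, Real.fourierInv_eq]
    refine integral_congr_ae ?_
    filter_upwards [hk t] with u hu
    rw [hu, kernelHat, Circle.smul_def, smul_eq_mul, ← mul_assoc, ← Circle.coe_mul,
      ← AddChar.map_add_eq_mul, inner_sub_right, sub_eq_add_neg]

end kernel

theorem enorm_symbol_sq {d : ℕ} (α : Fin d → ℕ) (u : EuclideanSpace ℝ (Fin d)) :
    ‖symbol α u‖ₑ ^ 2 = ENNReal.ofReal (∏ j, (2 * Real.pi * u j) ^ (2 * α j)) := by
  rw [← ofReal_norm, ← ENNReal.ofReal_pow (norm_nonneg _)]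
  congr 1
  rw [symbol, norm_prod, ← Finset.prod_pow]
  refine Finset.prod_congr rfl fun j _ => ?_
  rw [norm_pow, ← pow_mul, mul_comm (α j), pow_mul, pow_mul]
  congr 1
  simp [mul_pow]

/-- The integrand of the kernel formula is itself a `kernelHat`, so its integrability comes from
`integrable_kernelHat`. -/
theorem kernelHat_sub_eq {d : ℕ} {s : ℕ∞} (x t u : EuclideanSpace ℝ (Fin d)) :
    kernelHat d s (t - x) u =
      (Real.fourierChar (inner ℝ u (x - t)) : ℂ) * ((weight d s u).toReal : ℂ) := by
  rw [kernelHat, ← inner_neg_right, neg_sub]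

theorem prod_pow_nonneg {d : ℕ} (α : Fin d → ℕ) (u : EuclideanSpace ℝ (Fin d)) :
    0 ≤ ∏ j, (2 * Real.pi * u j) ^ (2 * α j) :=
  Finset.prod_nonneg fun j _ => by rw [pow_mul]; positivity

/-! ### Finite order: polynomial denominator and its growth -/

section finite

variable {d s : ℕ}

theorem sqSum_natCast (u : EuclideanSpace ℝ (Fin d)) :
    sqSum d s u = ENNReal.ofReal
      (1 + ∑ α ∈ nonzeroMultiIndices d s, ∏ j, (2 * Real.pi * u j) ^ (2 * α j)) := by
  have hmem : ∀ α : Fin d → ℕ, (((∑ j, α j : ℕ) : ℕ∞) ≤ s) ↔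
      α ∈ insert 0 (nonzeroMultiIndices d s) := by
    intro α
    rw [Nat.cast_le, Finset.mem_insert, mem_nonzeroMultiIndices]
    constructor
    · intro h
      rcases Nat.eq_zero_or_pos (∑ j, α j) with h0 | h0
      · left
        funext j
        exact (Finset.sum_eq_zero_iff.1 h0) j (Finset.mem_univ j)
      · exact Or.inr ⟨h0, h⟩
    · rintro (rfl | h)
      · simp
      · exact h.2
  have h0 : (0 : Fin d → ℕ) ∉ nonzeroMultiIndices d s := by
    simp [mem_nonzeroMultiIndices]
  have h1 : sqSum d s u = ∑' α : {α // α ∈ insert 0 (nonzeroMultiIndices d s)},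
      ‖symbol α.1 u‖ₑ ^ 2 :=
    (Equiv.subtypeEquivRight hmem).tsum_eq
      (fun α : {α // α ∈ insert 0 (nonzeroMultiIndices d s)} => ‖symbol α.1 u‖ₑ ^ 2)
  rw [h1, Finset.tsum_subtype (insert 0 (nonzeroMultiIndices d s))
    (fun α => ‖symbol α u‖ₑ ^ 2), Finset.sum_insert h0]
  simp only [enorm_symbol_sq]
  rw [ENNReal.ofReal_add zero_le_one (Finset.sum_nonneg fun α _ => prod_pow_nonneg α u),
    ENNReal.ofReal_sum_of_nonneg fun α _ => prod_pow_nonneg α u]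
  simp

theorem denominator_pos (u : EuclideanSpace ℝ (Fin d)) :
    0 < 1 + ∑ α ∈ nonzeroMultiIndices d s, ∏ j, (2 * Real.pi * u j) ^ (2 * α j) :=
  add_pos_of_pos_of_nonneg one_pos (Finset.sum_nonneg fun α _ => prod_pow_nonneg α u)

theorem weight_natCast (u : EuclideanSpace ℝ (Fin d)) :
    weight d s u = ENNReal.ofReal
      (1 + ∑ α ∈ nonzeroMultiIndices d s, ∏ j, (2 * Real.pi * u j) ^ (2 * α j))⁻¹ := by
  rw [weight, sqSum_natCast, ENNReal.ofReal_inv_of_pos (denominator_pos u)]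

/-- Among the terms of the denominator, the 1 and the pure power of order s in the largest
coordinate u_i already suffice, because |u|² ≤ d u_i². -/
theorem one_add_norm_pow_le (hd : 0 < d) (hs : 0 < s) (u : EuclideanSpace ℝ (Fin d)) :
    (1 + ‖u‖) ^ (2 * s) ≤ (2 * (1 + d)) ^ s *
      (1 + ∑ α ∈ nonzeroMultiIndices d s, ∏ j, (2 * Real.pi * u j) ^ (2 * α j)) := by
  have : Nonempty (Fin d) := ⟨⟨0, hd⟩⟩
  obtain ⟨i, hi⟩ := Finite.exists_max fun j => u j ^ 2
  have hnorm : ‖u‖ ^ 2 ≤ d * u i ^ 2 := by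
    rw [EuclideanSpace.real_norm_sq_eq]
    simpa using Finset.sum_le_card_nsmul Finset.univ (fun j => u j ^ 2) (u i ^ 2)
      fun j _ => hi j
  have hmem : Pi.single i s ∈ nonzeroMultiIndices d s := by
    rw [mem_nonzeroMultiIndices, Finset.sum_pi_single']
    simp [hs]
  have hterm : (u i ^ 2) ^ s ≤
      ∑ α ∈ nonzeroMultiIndices d s, ∏ j, (2 * Real.pi * u j) ^ (2 * α j) := by
    refine le_trans ?_ (Finset.single_le_sum (fun α _ => prod_pow_nonneg α u) hmem)
    rw [Finset.prod_eq_single i]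
    · rw [Pi.single_eq_same, pow_mul]
      refine pow_le_pow_left₀ (sq_nonneg _) ?_ _
      rw [mul_pow]
      have : 1 ≤ (2 * Real.pi) ^ 2 := one_le_pow₀ (by linarith [Real.pi_gt_three])
      exact le_mul_of_one_le_left (sq_nonneg _) this
    · intro j _ hj
      simp [Pi.single_eq_of_ne hj]
    · simp
  -- With m ≥ 1 and m ≥ u_i², (1 + |u|)² ≤ 2(1 + |u|²) ≤ 2(1 + d)m. Taking the maximum rather than 1
  -- + u_i² keeps m^s ≤ 1 + u_i^{2s} free of binomial constants.
  set m := max 1 (u i ^ 2)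
  have hm1 : 1 ≤ m := le_max_left _ _
  have hm2 : u i ^ 2 ≤ m := le_max_right _ _
  have hmp : m ^ s ≤ 1 + (u i ^ 2) ^ s := by
    rcases max_choice 1 (u i ^ 2) with h | h
    · rw [show m = 1 from h, one_pow]
      exact le_add_of_nonneg_right (by positivity)
    · rw [show m = u i ^ 2 from h]
      exact le_add_of_nonneg_left zero_le_one
  have hd0 : (0 : ℝ) ≤ d := Nat.cast_nonneg d
  calc (1 + ‖u‖) ^ (2 * s) = ((1 + ‖u‖) ^ 2) ^ s := pow_mul _ _ _
    _ ≤ (2 * (1 + d) * m) ^ s := by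
        refine pow_le_pow_left₀ (by positivity) ?_ _
        have h2 : (d : ℝ) * u i ^ 2 ≤ d * m := mul_le_mul_of_nonneg_left hm2 hd0
        nlinarith [sq_nonneg (1 - ‖u‖)]
    _ = (2 * (1 + d)) ^ s * m ^ s := mul_pow _ _ _
    _ ≤ _ := by gcongr; linarith

theorem integrable_inv_denominator (hd : 0 < d) (hs : (d : ℝ) / 2 < s) :
    Integrable fun u : EuclideanSpace ℝ (Fin d) =>
      (1 + ∑ α ∈ nonzeroMultiIndices d s, ∏ j, (2 * Real.pi * u j) ^ (2 * α j))⁻¹ := by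
  have hs0 : 0 < s := by
    have : (0 : ℝ) < s := lt_of_le_of_lt (by positivity) hs
    exact_mod_cast this
  have h1 : Integrable fun u : EuclideanSpace ℝ (Fin d) =>
      ((2 * (1 + d)) ^ s : ℝ) * (1 + ‖u‖) ^ (-((2 * s : ℕ) : ℝ)) := by
    -- The decay exponent 2s must exceed the dimension, which is the assumption s > d/2.
    refine (integrable_one_add_norm ?_).const_mul _
    rw [finrank_euclideanSpace, Fintype.card_fin]
    push_cast
    linarith
  refine h1.mono' ?_ (Filter.Eventually.of_forall fun u => ?_)
  · refine Continuous.aestronglyMeasurable (Continuous.inv₀ (by fun_prop) fun u => ?_)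
    exact (denominator_pos u).ne'
  · have hp : 0 < 1 + ‖u‖ := by positivity
    rw [Real.norm_of_nonneg (inv_nonneg.2 (denominator_pos u).le), Real.rpow_neg hp.le,
      Real.rpow_natCast, ← div_eq_mul_inv, inv_eq_one_div,
      div_le_div_iff₀ (denominator_pos u) (pow_pos hp _), one_mul]
    exact one_add_norm_pow_le hd hs0 u

theorem lintegral_weight_natCast_ne_top (hd : 0 < d) (hs : (d : ℝ) / 2 < s) :
    ∫⁻ u, weight d s u ≠ ⊤ := by
  simp only [weight_natCast]
  exact (integrable_inv_denominator hd hs).lintegral_lt_top.ne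

theorem kernelIntegrand_eq (x t u : EuclideanSpace ℝ (Fin d)) :
    kernelIntegrand d s x t u = kernelHat d s (t - x) u := by
  rw [kernelHat_sub_eq, kernelIntegrand, weight_natCast,
    ENNReal.toReal_ofReal (inv_nonneg.2 (denominator_pos u).le), Real.fourierChar_apply,
    div_eq_mul_inv, ← Complex.ofReal_inv]
  congr 2
  have : inner ℝ u (x - t) = ∑ j, (x j - t j) * u j := by
    simp [PiLp.inner_apply]
  rw [this]
  push_cast
  ring

end finite

/-! ### Infinite order: geometric series and the explicit product kernel -/

section infinite

/-- Distributivity by induction on d, splitting off the first coordinate; in `ℝ≥0∞` no summability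
is required. -/
theorem tsum_prod_eq_prod_tsum {d : ℕ} (f : Fin d → ℕ → ℝ≥0∞) :
    ∑' α : Fin d → ℕ, ∏ j, f j (α j) = ∏ j, ∑' n, f j n := by
  induction d with
  | zero => simp
  | succ d ih =>
    rw [← (Fin.consEquiv fun _ : Fin (d + 1) => ℕ).tsum_eq, ENNReal.tsum_prod', Fin.prod_univ_succ,
      ← ih, ← ENNReal.tsum_mul_right]
    refine tsum_congr fun n => ?_
    rw [← ENNReal.tsum_mul_left]
    refine tsum_congr fun α => ?_
    rw [Fin.prod_univ_succ]
    simp [Fin.consEquiv]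

/-- The univariate weight of the Sobolev space of infinite order. -/
def bump (v : ℝ) : ℝ := max (1 - (2 * Real.pi * v) ^ 2) 0

theorem bump_nonneg (v : ℝ) : 0 ≤ bump v := le_max_right _ _

theorem continuous_bump : Continuous bump := by
  unfold bump
  fun_prop

theorem ofReal_bump (v : ℝ) :
    ENNReal.ofReal (bump v) = 1 - ENNReal.ofReal ((2 * Real.pi * v) ^ 2) := by
  have h : ENNReal.ofReal (bump v) = ENNReal.ofReal (1 - (2 * Real.pi * v) ^ 2) := by
    rw [bump, ENNReal.ofReal_max, ENNReal.ofReal_zero]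
    simp
  rw [h, ENNReal.ofReal_sub _ (sq_nonneg _), ENNReal.ofReal_one]

/-- With q_j = (2πu_j)², the sum over all α of ∏ q_j^{α_j} is ∏ (1 - q_j)⁻¹. Truncated subtraction
in `ℝ≥0∞` makes a factor infinite when q_j ≥ 1, so inverting yields the positive part of 1 - q_j. -/
theorem weight_top {d : ℕ} (u : EuclideanSpace ℝ (Fin d)) :
    weight d ⊤ u = ENNReal.ofReal (∏ j, bump (u j)) := by
  have h1 : sqSum d ⊤ u = ∑' α : Fin d → ℕ, ‖symbol α u‖ₑ ^ 2 :=
    (Equiv.subtypeUnivEquiv (p := fun α : Fin d → ℕ => ((∑ j, α j : ℕ) : ℕ∞) ≤ ⊤)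
      fun _ => le_top).tsum_eq (fun α : Fin d → ℕ => ‖symbol α u‖ₑ ^ 2)
  have h2 : ∀ α : Fin d → ℕ, ‖symbol α u‖ₑ ^ 2 =
      ∏ j, ENNReal.ofReal ((2 * Real.pi * u j) ^ 2) ^ α j := by
    intro α
    rw [enorm_symbol_sq, ENNReal.ofReal_prod_of_nonneg fun j _ => by rw [pow_mul]; positivity]
    refine Finset.prod_congr rfl fun j _ => ?_
    rw [pow_mul, ENNReal.ofReal_pow (sq_nonneg _)]
  rw [weight, h1]
  simp only [h2]
  rw [tsum_prod_eq_prod_tsum fun j n => ENNReal.ofReal ((2 * Real.pi * u j) ^ 2) ^ n]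
  simp only [ENNReal.tsum_geometric]
  rw [ENNReal.prod_inv_distrib, ENNReal.ofReal_prod_of_nonneg fun j _ => bump_nonneg _]
  · simp only [inv_inv, ofReal_bump]
  -- Inverting the product requires excluding 0 · ∞; no factor (1 - q)⁻¹ is zero because 1 - q is
  -- finite.
  · intro i _ j _ _
    left
    simp

theorem pi_mul_inv_two_pi : 2 * Real.pi * (1 / (2 * Real.pi)) = 1 := by
  field_simp

/-- The half-open interval is the form needed to turn the integral over ℝ into an interval integral.
-/
theorem support_bump_subset :
    Function.support bump ⊆ Set.Ioc (-(1 / (2 * Real.pi))) (1 / (2 * Real.pi)) := by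
  intro v hv
  have hp : 0 < 2 * Real.pi := by positivity
  have h1 : (2 * Real.pi * v) ^ 2 < 1 := by
    by_contra h
    exact hv (max_eq_right (by linarith))
  obtain ⟨h2, h3⟩ := abs_lt.1 ((sq_lt_one_iff_abs_lt_one _).1 h1)
  have h4 := pi_mul_inv_two_pi
  constructor
  · by_contra h
    nlinarith
  · by_contra h
    nlinarith

theorem bump_eq_of_mem {v : ℝ} (hv : v ∈ Set.uIcc (-(1 / (2 * Real.pi))) (1 / (2 * Real.pi))) :
    bump v = 1 - (2 * Real.pi * v) ^ 2 := by
  have hp : 0 < 2 * Real.pi := by positivity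
  rw [Set.uIcc_of_le (by linarith [one_div_pos.2 hp])] at hv
  refine max_eq_left ?_
  have h4 := pi_mul_inv_two_pi
  have h1 : |2 * Real.pi * v| ≤ 1 := by
    rw [abs_le]
    constructor <;> nlinarith [hv.1, hv.2]
  linarith [(sq_le_one_iff_abs_le_one _).2 h1]

theorem integrable_bump : Integrable bump := by
  refine continuous_bump.integrable_of_hasCompactSupport ?_
  exact HasCompactSupport.of_support_subset_isCompact isCompact_Icc
    (support_bump_subset.trans Set.Ioc_subset_Icc_self)

theorem integral_one_sub_sq_mul_exp (z : ℝ) :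
    ∫ w in (-1 : ℝ)..1, Complex.exp ((z * w : ℝ) * Complex.I) * ((1 - w ^ 2 : ℝ) : ℂ) =
      2 * Real.pi * (varenna z : ℂ) := by
  by_cases hz : z = 0
  · subst hz
    have h : ∫ w in (-1 : ℝ)..1, (1 - w ^ 2) = 4 / 3 := by
      rw [intervalIntegral.integral_sub (by simp) (by simp)]
      norm_num
    simp only [zero_mul, Complex.ofReal_zero, Complex.exp_zero, one_mul]
    rw [intervalIntegral.integral_ofReal, h, varenna, if_pos rfl]
    have : (Real.pi : ℂ) ≠ 0 := by exact_mod_cast Real.pi_ne_zero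
    push_cast
    field_simp
    norm_num
  have hz' : (z : ℂ) ≠ 0 := by exact_mod_cast hz
  have hI : Complex.I ^ 2 = -1 := Complex.I_sq
  -- The antiderivative comes from integrating e^{izw}(1 - w²) by parts twice. The term with 1 - w²
  -- vanishes at ±1, so only the other two reach the result.
  have hderiv : ∀ w : ℝ, HasDerivAt (fun w : ℝ => Complex.exp ((z * w : ℝ) * Complex.I) *
      (-(1 - (w : ℂ) ^ 2) * Complex.I / z - 2 * w / z ^ 2 - 2 * Complex.I / z ^ 3))
      (Complex.exp ((z * w : ℝ) * Complex.I) * ((1 - w ^ 2 : ℝ) : ℂ)) w := by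
    intro w
    have h0 : HasDerivAt (fun w : ℝ => (w : ℂ)) 1 w := Complex.ofRealCLM.hasDerivAt
    have h1 : HasDerivAt (fun w : ℝ => Complex.exp ((z * w : ℝ) * Complex.I))
        (Complex.exp ((z * w : ℝ) * Complex.I) * (z * Complex.I)) w := by
      have h2 : HasDerivAt (fun w : ℝ => (((z * w : ℝ) : ℂ) * Complex.I)) (z * Complex.I) w := by
        simpa using (h0.const_mul (z : ℂ)).mul_const Complex.I
      exact h2.cexp
    have h3 : HasDerivAt (fun w : ℝ =>
        (-(1 - (w : ℂ) ^ 2) * Complex.I / z - 2 * w / z ^ 2 - 2 * Complex.I / z ^ 3))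
        (2 * w * Complex.I / z - 2 / z ^ 2) w := by
      have h4 := ((((h0.pow 2).const_sub 1).neg.mul_const Complex.I).div_const (z : ℂ)).sub
        ((h0.const_mul 2).div_const ((z : ℂ) ^ 2)) |>.sub_const (2 * Complex.I / z ^ 3)
      convert! h4 using 1
      simp
    convert! h1.mul h3 using 1
    push_cast
    field_simp
    linear_combination ((1 - (w : ℂ) ^ 2) * z ^ 2 + 2) * hI
  rw [intervalIntegral.integral_eq_sub_of_hasDerivAt (fun w _ => hderiv w)
    (Continuous.intervalIntegrable (by fun_prop) _ _)]
  have e1 : Complex.exp ((z * (1 : ℝ) : ℝ) * Complex.I) =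
      Real.cos z + Real.sin z * Complex.I := by
    rw [mul_one, Complex.exp_mul_I, ← Complex.ofReal_cos, ← Complex.ofReal_sin]
  have e2 : Complex.exp ((z * (-1 : ℝ) : ℝ) * Complex.I) =
      Real.cos z - Real.sin z * Complex.I := by
    rw [mul_neg_one, Complex.exp_mul_I, ← Complex.ofReal_cos, ← Complex.ofReal_sin, Real.cos_neg,
      Real.sin_neg]
    push_cast
    ring
  rw [e1, e2, varenna, if_neg hz]
  have : (Real.pi : ℂ) ≠ 0 := by exact_mod_cast Real.pi_ne_zero
  push_cast
  field_simp
  linear_combination (-4 * Complex.sin z) * hI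

theorem integral_exp_mul_bump (z : ℝ) :
    ∫ v : ℝ, Complex.exp ((2 * Real.pi * (z * v) : ℝ) * Complex.I) * (bump v : ℂ) =
      (varenna z : ℂ) := by
  have hsub : (Function.support fun v : ℝ =>
      Complex.exp ((2 * Real.pi * (z * v) : ℝ) * Complex.I) * (bump v : ℂ)) ⊆
      Set.Ioc (-(1 / (2 * Real.pi))) (1 / (2 * Real.pi)) := by
    refine subset_trans (fun v hv => ?_) support_bump_subset
    intro h
    exact hv (by simp [h])
  have hp : 2 * Real.pi ≠ 0 := by positivity
  have hpc : (Real.pi : ℂ) ≠ 0 := by exact_mod_cast Real.pi_ne_zero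
  rw [← intervalIntegral.integral_eq_integral_of_support_subset hsub]
  -- The substitution w = 2πv carries the support to [-1, 1]; its factor 1/(2π) cancels the 2π in
  -- `integral_one_sub_sq_mul_exp`.
  have h1 := intervalIntegral.integral_comp_mul_left (a := -(1 / (2 * Real.pi)))
    (b := 1 / (2 * Real.pi))
    (fun w : ℝ => Complex.exp ((z * w : ℝ) * Complex.I) * ((1 - w ^ 2 : ℝ) : ℂ)) hp
  rw [mul_neg, pi_mul_inv_two_pi, integral_one_sub_sq_mul_exp] at h1
  refine (intervalIntegral.integral_congr fun v hv => ?_).trans (h1.trans ?_)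
  · simp only [bump_eq_of_mem hv]
    congr 4
    ring
  · rw [Complex.real_smul]
    push_cast
    field_simp

theorem lintegral_weight_top_ne_top (d : ℕ) : ∫⁻ u, weight d ⊤ u ≠ ⊤ := by
  have h1 : Integrable fun u : Fin d → ℝ => ∏ j, bump (u j) :=
    Integrable.fintype_prod fun _ => integrable_bump
  have h2 : Integrable fun u : EuclideanSpace ℝ (Fin d) => ∏ j, bump (u j) :=
    (PiLp.volume_preserving_ofLp (Fin d)).integrable_comp_of_integrable h1
  simp only [weight_top]
  exact h2.lintegral_lt_top.ne

/-- Both the character and the weight factor over the coordinates, so Fubini reduces the integral to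
`integral_exp_mul_bump`. -/
theorem integral_fourierChar_mul_weight_top {d : ℕ} (z : EuclideanSpace ℝ (Fin d)) :
    ∫ u, (Real.fourierChar (inner ℝ u z) : ℂ) * ((weight d ⊤ u).toReal : ℂ) =
      ((∏ j, varenna (z j) : ℝ) : ℂ) := by
  have h1 : ∀ u : EuclideanSpace ℝ (Fin d),
      (Real.fourierChar (inner ℝ u z) : ℂ) * ((weight d ⊤ u).toReal : ℂ) =
      ∏ j, (Complex.exp ((2 * Real.pi * (z j * u j) : ℝ) * Complex.I) * (bump (u j) : ℂ)) := by
    intro u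
    rw [weight_top, ENNReal.toReal_ofReal (Finset.prod_nonneg fun j _ => bump_nonneg _),
      Finset.prod_mul_distrib, ← Complex.exp_sum, Real.fourierChar_apply, PiLp.inner_apply]
    push_cast
    rw [Finset.mul_sum, Finset.sum_mul]
    simp
  simp only [h1]
  have h2 := (EuclideanSpace.volume_preserving_symm_measurableEquiv_toLp (Fin d)).integral_comp'
    fun u : Fin d → ℝ =>
      ∏ j, (Complex.exp ((2 * Real.pi * (z j * u j) : ℝ) * Complex.I) * (bump (u j) : ℂ))
  refine Eq.trans h2 ?_
  rw [integral_fintype_prod_volume_eq_prod fun (j : Fin d) (v : ℝ) =>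
    Complex.exp ((2 * Real.pi * (z j * v) : ℝ) * Complex.I) * (bump v : ℂ)]
  simp only [integral_exp_mul_bump]
  push_cast
  rfl

end infinite

end SobolevKernel

end

theorem theorem1 (d : ℕ) (hd : 0 < d) :
    (∀ s : ℕ, (d : ℝ) / 2 < s →
      ∃ R : RKHS ℂ (SobolevKernel.sobolevSpace d s) (EuclideanSpace ℝ (Fin d)) ℂ,
        (∀ f : SobolevKernel.sobolevSpace d s,
          Continuous (R.coeCLM f) ∧ R.coeCLM f =ᵐ[volume] SobolevKernel.toL2 f) ∧
        ∀ x t : EuclideanSpace ℝ (Fin d),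
          Integrable (SobolevKernel.kernelIntegrand d s x t) volume ∧
          RKHS.kernel (SobolevKernel.sobolevSpace d s) x t 1 =
            ∫ u, SobolevKernel.kernelIntegrand d s x t u) ∧
    (∃ R : RKHS ℂ (SobolevKernel.sobolevSpace d ⊤) (EuclideanSpace ℝ (Fin d)) ℂ,
      (∀ f : SobolevKernel.sobolevSpace d ⊤,
        Continuous (R.coeCLM f) ∧ R.coeCLM f =ᵐ[volume] SobolevKernel.toL2 f) ∧
      ∀ x t : EuclideanSpace ℝ (Fin d),
        RKHS.kernel (SobolevKernel.sobolevSpace d ⊤) x t 1 =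
          ((∏ j, SobolevKernel.varenna (x j - t j) : ℝ) : ℂ)) := by
  refine ⟨fun s hs => ?_, ?_⟩
  · have hw := SobolevKernel.lintegral_weight_natCast_ne_top hd hs
    obtain ⟨R, hR, hK⟩ := SobolevKernel.exists_rkhs hw
    refine ⟨R, hR, fun x t => ⟨?_, ?_⟩⟩
    · exact (SobolevKernel.integrable_kernelHat hw (t - x)).congr
        (Filter.Eventually.of_forall fun u => (SobolevKernel.kernelIntegrand_eq x t u).symm)
    · rw [hK]
      simp only [SobolevKernel.kernelIntegrand_eq, SobolevKernel.kernelHat_sub_eq]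
  · obtain ⟨R, hR, hK⟩ := SobolevKernel.exists_rkhs (SobolevKernel.lintegral_weight_top_ne_top d)
    refine ⟨R, hR, fun x t => ?_⟩
    rw [hK, SobolevKernel.integral_fourierChar_mul_weight_top]
    simp
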